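/- **Setting.** Let $D\ge 1$, let $\mathcal X\subset\mathbb R^D$ be compact, let $P_{\mathcal X}$ be a probability measure on $\mathcal X$, and let $\eta:\mathcal X\to[0,1]$ be measurable. Let $\mathcal F$ be the law of $(x,y)\in\mathcal X\times\{0,1\}$ with $x\sim P_{\mathcal X}$ and $\mathbb P(y=1\mid x)=\eta(x)$. Write $B(x,r)$ for the closed Euclidean ball, $\mathcal X^{\Delta}:=\{x\in\mathcal X: |\tfrac12-\eta(x)|\ge\Delta\}$, $\eta^*(x):=\mathbf 1[\eta(x)\ge\tfrac12]$ for the Bayes classifier, and $S_2(C):=\min_{x,x'\in C,\,x\ne x'}|x-x'|$ for a finite set $C$ (with $S_2(C)=\infty$ if $C$ has at most one point). Assume: 1. there are $\omega,r_0>0$ such that $\mathrm{Vol}(\mathcal X\cap B(x,r))\ge\omega\,\mathrm{Vol}(B(x,r))$ for all $x\in\mathcal X$ and $0<r<r_0$; 2. $P_{\mathcal X}$ has a density $p_X$ with respect to Lebesgue measure on $\mathcal X$, and $\inf_{x\in\mathcal X}p_X(x)>0$; 3. $0<\alpha\le1$, and there is $C_\alpha>0$ with $|\eta(x)-\eta(x')|\le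 C_\alpha|x-x'|^\alpha$ for all $x,x'\in\mathcal X$; 4. (Tsybakov's noise condition) there is $C_\beta$ such that $P_{\mathcal X}(x\notin\mathcal X^\Delta)\le C_\beta\Delta^\beta$ for all $\Delta>0$. For a finite labelled sample $(x_i,y_i)_i$ in $\mathcal X\times\{0,1\}$ and $k\ge1$, let $r_k(x)$ be the infimum of the radii $r$ such that $B(x,r)$ contains at least $k$ sample points (with $\inf\emptyset=\infty$), let $N_k(x)$ be the set of sample points in $B(x,r_k(x))$, and let $\eta_k(y;x)$ be the fraction of the points of $N_k(x)$ that have label $y$. A $k$-NN classifier is a measurable function $\eta_k:\mathcal X\to\{0,1\}$ with $\eta_k(x)\in\arg\max_y\eta_k(y;x)$ for every $x$ (ties may be broken in any measurable way). **Theorem.** There are constants $K_l,K_u,K,K'>0$, depending only on $\mathcal F$ (and on the exponents $\alpha,\beta$), such that for all $\delta>0$ and $n\ge1$ the following holds with probability at least $1-\delta$ over $n$ i.i.d. (clean) examples $X_{[n]}$ drawn from $\mathcal F$. For every finite set $C\subset\mathcal X$ of points with arbitrary (corrupted) labels, every integer $k\ge1$ with $$K_l\,\log^2(1/\delta)\,n^{\frac{\alpha}{\alpha+D}}\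 \le\ k\ \le\ K_u\,S_2(C)^D\,n ,$$ and every $k$-NN classifier $\eta_k$ with respect to the sample $X:=X_{[n]}\cup C$, $$P_{\mathcal X}\big(\eta_k(x)\ne\eta^*(x)\big)\le K\lambda^\beta,\qquad R_X-R^*\le K'\lambda^{\beta+1},\qquad \lambda:=\sqrt{\frac{\log n+\log(1/\delta)}{k}}+\Big(\frac kn\Big)^{\alpha/D},$$ where $R_X:=\mathbb P_{(x,y)\sim\mathcal F}(\eta_k(x)\ne y)$ and $R^*:=\mathbb P_{(x,y)\sim\mathcal F}(\eta^*(x)\ne y)$. Moreover, for all $a,b$ with $a>0$ there is a constant $K''>0$, depending only on $\mathcal F,\alpha,\beta,a,b$, such that on the same event, whenever in addition $a\,n^{2\alpha/(2\alpha+D)}\le k\le b\,n^{2\alpha/(2\alpha+D)}$, $$R_X-R^*\le K''\,\big(1+\log n+\log(1/\delta)\big)^{\frac{\beta+1}{2}}\,n^{-\frac{\alpha(\beta+1)}{2\alpha+D}},$$ that is, the excess risk is $\widetilde O\big(n^{-\alpha(\beta+1)/(2\alpha+D)}\big)$. -/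

import Mathlib

open MeasureTheory
open scoped ENNReal

/-- Law of a labelled example `(X, Y)`: `X ∼ P` and `Y ∈ {0, 1}` with `ℙ(Y = 1 | X = x) = η x`. -/
noncomputable def jointLaw {M : Type*} [MeasurableSpace M] (P : Measure M) (η : M → ℝ) :
    Measure (M × Fin 2) :=
  (P.withDensity fun x => ENNReal.ofReal (η x)).map (fun x => (x, 1)) +
    (P.withDensity fun x => ENNReal.ofReal (1 - η x)).map (fun x => (x, 0))

/-- Support regularity: `𝒳` does not become arbitrarily thin anywhere. -/
def SupportRegular {D : ℕ} (𝒳 : Set (EuclideanSpace ℝ (Fin D))) : Prop :=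
  ∃ ω r₀ : ℝ, 0 < ω ∧ 0 < r₀ ∧ ∀ x ∈ 𝒳, ∀ r : ℝ, 0 < r → r < r₀ →
    ENNReal.ofReal ω * volume (Metric.closedBall x r) ≤ volume (𝒳 ∩ Metric.closedBall x r)

/-- `P` has a density with respect to Lebesgue measure on `𝒳`, with positive infimum over `𝒳`. -/
def DensityBoundedBelow {D : ℕ} {𝒳 : Set (EuclideanSpace ℝ (Fin D))} (P : Measure 𝒳) : Prop :=
  ∃ p : 𝒳 → ℝ≥0∞, Measurable p ∧
    P = ((volume : Measure (EuclideanSpace ℝ (Fin D))).comap Subtype.val).withDensity p ∧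
    0 < ⨅ x, p x

/-- Hölder continuity with exponent `α`, for some constant. -/
def HolderRegular {M : Type*} [MetricSpace M] (η : M → ℝ) (α : ℝ) : Prop :=
  ∃ Cα : ℝ, 0 < Cα ∧ ∀ x x' : M, |η x - η x'| ≤ Cα * dist x x' ^ α

/-- The region where the margin is at least `Δ`. -/
def marginRegion {M : Type*} (η : M → ℝ) (Δ : ℝ) : Set M := {x | Δ ≤ |1 / 2 - η x|}

/-- Tsybakov's noise condition with exponent `β`, for some constant. -/
def TsybakovNoise {M : Type*} [MeasurableSpace M] (P : Measure M) (η : M → ℝ) (β : ℝ) : Prop :=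
  ∃ Cβ : ℝ, ∀ Δ : ℝ, 0 < Δ → P.real (marginRegion η Δ)ᶜ ≤ Cβ * Δ ^ β

open Classical in
/-- The Bayes-optimal classifier `1[η x ≥ 1/2]`. -/
noncomputable def bayes {M : Type*} (η : M → ℝ) (x : M) : Fin 2 :=
  if 1 / 2 ≤ η x then 1 else 0

/-- The risk `ℙ(g(X) ≠ Y)` of the classifier `g` under `F`. -/
noncomputable def risk {M : Type*} [MeasurableSpace M] (F : Measure (M × Fin 2))
    (g : M → Fin 2) : ℝ :=
  F.real {z | g z.1 ≠ z.2}

/-- The `k`-NN radius of `x`: the infimum of the `r` such that the closed ball of radius `r` about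
`x` holds at least `k` sample points (`∞` when the sample has fewer than `k` points). -/
noncomputable def knnRadius {M ι : Type*} [MetricSpace M] [Fintype ι]
    (k : ℕ) (z : ι → M × Fin 2) (x : M) : ℝ≥0∞ :=
  sInf {r : ℝ≥0∞ | k ≤ Nat.card {i : ι // edist (z i).1 x ≤ r}}

open Classical in
/-- The (indices of the) `k`-NN set of `x`. -/
noncomputable def knnSet {M ι : Type*} [MetricSpace M] [Fintype ι]
    (k : ℕ) (z : ι → M × Fin 2) (x : M) : Finset ι :=
  {i | edist (z i).1 x ≤ knnRadius k z x}

open Classical in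
/-- The `k`-NN discriminant function `η_k(y; x)`. -/
noncomputable def knnScore {M ι : Type*} [MetricSpace M] [Fintype ι]
    (k : ℕ) (z : ι → M × Fin 2) (y : Fin 2) (x : M) : ℝ :=
  (1 / ((knnSet k z x).card : ℝ)) *
    ∑ i, if (z i).2 = y ∧ i ∈ knnSet k z x then (1 : ℝ) else 0

/-- `g` is a `k`-NN classifier for the sample `z`: `g x ∈ argmax_y η_k(y; x)` for every `x`, with
ties broken in any (measurable) way. -/
def IsKNNClassifier {M ι : Type*} [MetricSpace M] [MeasurableSpace M] [Fintype ι]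
    (k : ℕ) (z : ι → M × Fin 2) (g : M → Fin 2) : Prop :=
  Measurable g ∧ ∀ x y, knnScore k z y x ≤ knnScore k z (g x) x

/-- The sample made of the clean examples `s` and of the points of `C` with labels `ℓ`. -/
def corruptedSample {M : Type*} {n : ℕ} (s : Fin n → M × Fin 2) (C : Finset M) (ℓ : M → Fin 2) :
    Fin n ⊕ C → M × Fin 2 :=
  Sum.elim s fun c => (c.1, ℓ c.1)

/-- `k` lies in the admissible range. `Set.einfsep C` is the minimum pairwise distance of `C`
(`∞` when `C` has at most one point). -/
def KRange {M : Type*} [MetricSpace M] (D : ℕ) (α δ Kl Ku : ℝ) (n k : ℕ) (C : Finset M) : Prop :=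
  Kl * Real.log (1 / δ) ^ 2 * (n : ℝ) ^ (α / (α + D)) ≤ k ∧
    (k : ℝ≥0∞) ≤ ENNReal.ofReal Ku * Set.einfsep (C : Set M) ^ D * n

/-- `λ = √((log n + log (1/δ)) / k) + (k/n)^(α/D)`. -/
noncomputable def rateLambda (D : ℕ) (α δ : ℝ) (n k : ℕ) : ℝ :=
  √((Real.log n + Real.log (1 / δ)) / k) + ((k : ℝ) / n) ^ (α / D)

/-!
A `k`-NN classifier fails at `x` only if the empirical label frequency among the neighbours of `x`
is far from `η x`. Three things move it: the randomness of the clean labels, the variation of `η`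
over the ball that holds the neighbours, and the corrupted points. With `L = log n + log (1 / δ)`
they contribute `O(√(L / k))`, `O((k / n) ^ (α / D))` and `O(1 / k)`, so in total `O(λ)`:

* `SupportRegular` and `DensityBoundedBelow` give every ball of radius `r` mass at least `c r ^ D`
  (`exists_ball_mass`), so the ball of radius `r_k` of the order of `(k / n) ^ (1 / D)` has mass at
  least `2 k / n` and holds `k` clean examples, by Chernoff (`pi_card_lt_le`). Hölder continuity
  bounds the bias in this ball.
* The upper bound on `k` makes the separation of the corrupted points larger than `2 r_k`, so that
  at most one of them is a neighbour (`two_mul_lt_dist_of_le_einfsep`). Whatever their labels, and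
  whatever radius they induce, the clean neighbours are all the clean examples in some ball about
  `x`. It therefore suffices to control the label noise in the `n` balls about `x` that have a clean
  example on their boundary; conditionally on that example the others are i.i.d., which leads to
  an exponential moment bound (`pi_closerNoise_le`).

These events concern one fixed `x`. No uniformity over `x` is needed: a fixed point is unreliable
with probability at most `δ n ^ (-γ)`, and by Fubini and Markov, with probability at least `1 - δ`
the unreliable points have measure at most `n ^ (-γ)` (`exists_event_reliable`). For
`γ = α (β + 1) / D` this is at most `λ ^ (β + 1)`. At the reliable points errors occur only where
the margin is `O(λ)` (`exists_event_margin_le`), and Tsybakov's condition bounds the measure of that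
region by `O(λ ^ β)`; the excess risk carries the margin as an additional factor
(`disagreement_and_excess_le`). When `λ` is bounded below the claims are trivial. This disposes of
the scales `k` for which `r_k` is too large or the exponential bounds are too weak.
-/

/-! ### The law of a labelled example -/

section JointLaw

variable {M : Type*} [MeasurableSpace M] {P : Measure M} {η : M → ℝ}

theorem lintegral_jointLaw (hη : Measurable η) {f : M × Fin 2 → ℝ≥0∞} (hf : Measurable f) :
    ∫⁻ z, f z ∂(jointLaw P η) =
      ∫⁻ x, (ENNReal.ofReal (η x) * f (x, 1) + ENNReal.ofReal (1 - η x) * f (x, 0)) ∂P := by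
  have h1 : Measurable fun x => ENNReal.ofReal (η x) := by fun_prop
  have h0 : Measurable fun x => ENNReal.ofReal (1 - η x) := by fun_prop
  have hf1 : Measurable fun x : M => f (x, 1) := by fun_prop
  have hf0 : Measurable fun x : M => f (x, 0) := by fun_prop
  unfold jointLaw
  rw [lintegral_add_measure, lintegral_map hf (by fun_prop), lintegral_map hf (by fun_prop),
    lintegral_withDensity_eq_lintegral_mul _ h1 hf1,
    lintegral_withDensity_eq_lintegral_mul _ h0 hf0, ← lintegral_add_left (h1.mul hf1)]
  rfl

theorem lintegral_jointLaw_fst (hη : Measurable η) (hη01 : ∀ x, η x ∈ Set.Icc (0 : ℝ) 1)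
    {f : M → ℝ≥0∞} (hf : Measurable f) :
    ∫⁻ z, f z.1 ∂(jointLaw P η) = ∫⁻ x, f x ∂P := by
  rw [lintegral_jointLaw hη (f := fun z => f z.1) (hf.comp measurable_fst)]
  refine lintegral_congr fun x => ?_
  rw [← add_mul, ← ENNReal.ofReal_add (hη01 x).1 (by linarith [(hη01 x).2])]
  simp

theorem isProbabilityMeasure_jointLaw [IsProbabilityMeasure P] (hη : Measurable η)
    (hη01 : ∀ x, η x ∈ Set.Icc (0 : ℝ) 1) : IsProbabilityMeasure (jointLaw P η) := by
  constructor
  have := lintegral_jointLaw_fst (P := P) hη hη01 (f := fun _ => 1) measurable_const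
  simpa using this

theorem jointLaw_preimage_fst (hη : Measurable η) (hη01 : ∀ x, η x ∈ Set.Icc (0 : ℝ) 1)
    {A : Set M} (hA : MeasurableSet A) : jointLaw P η (Prod.fst ⁻¹' A) = P A := by
  rw [← lintegral_indicator_one hA, ← lintegral_indicator_one (measurable_fst hA),
    ← lintegral_jointLaw_fst hη hη01 (measurable_one.indicator hA)]
  rfl

open Classical in
/-- The risk is the mean of the conditional probability of a wrong label. -/
theorem risk_eq_integral [IsProbabilityMeasure P] (hη : Measurable η)
    (hη01 : ∀ x, η x ∈ Set.Icc (0 : ℝ) 1) {g : M → Fin 2} (hg : Measurable g) :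
    risk (jointLaw P η) g = ∫ x, (if g x = 1 then 1 - η x else η x) ∂P := by
  have hset : MeasurableSet {z : M × Fin 2 | g z.1 ≠ z.2} :=
    (measurableSet_eq_fun (hg.comp measurable_fst) measurable_snd).compl
  have hmeas : Measurable fun x => if g x = 1 then 1 - η x else η x :=
    Measurable.ite (hg (measurableSet_singleton 1)) (by fun_prop) hη
  unfold risk
  rw [integral_eq_lintegral_of_nonneg_ae (Filter.Eventually.of_forall fun x => ?_)
    hmeas.aestronglyMeasurable, measureReal_def, ← lintegral_indicator_one hset,
    lintegral_jointLaw hη (measurable_one.indicator hset)]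
  · congr 1
    refine lintegral_congr fun x => ?_
    rcases Fin.exists_fin_two.mp ⟨g x, rfl⟩ with h | h <;> simp [h]
  · have := hη01 x
    show (0 : ℝ) ≤ if g x = 1 then 1 - η x else η x
    split_ifs
    · linarith [this.2]
    · exact this.1

theorem measurable_bayes (hη : Measurable η) : Measurable (bayes η) := by
  classical
  exact Measurable.ite (measurableSet_le measurable_const hη) measurable_const measurable_const

end JointLaw

/-! ### Exponential tail bounds for i.i.d. samples -/

/-- Markov's inequality for an exponential moment. -/
theorem measure_le_of_lintegral_exp_le {Ω : Type*} [MeasurableSpace Ω] {μ : Measure Ω}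
    {U : Ω → ℝ} (hU : Measurable U) {a : ℝ}
    (h : ∫⁻ ω, ENNReal.ofReal (Real.exp (U ω)) ∂μ ≤ ENNReal.ofReal a) (c : ℝ) :
    μ {ω | c ≤ U ω} ≤ ENNReal.ofReal (a * Real.exp (-c)) := by
  have hm : Measurable fun ω => ENNReal.ofReal (Real.exp (U ω)) := by fun_prop
  have hmk := (mul_meas_ge_le_lintegral (μ := μ) hm (ENNReal.ofReal (Real.exp c))).trans h
  have hset : {ω | ENNReal.ofReal (Real.exp c) ≤ ENNReal.ofReal (Real.exp (U ω))} =
      {ω | c ≤ U ω} := by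
    ext ω
    simp [ENNReal.ofReal_le_ofReal_iff (Real.exp_pos _).le]
  rw [hset] at hmk
  have h1 : ENNReal.ofReal (Real.exp (-c)) * ENNReal.ofReal (Real.exp c) = 1 := by
    rw [← ENNReal.ofReal_mul (Real.exp_pos _).le, ← Real.exp_add]
    simp
  calc μ {ω | c ≤ U ω}
      = ENNReal.ofReal (Real.exp (-c)) *
          (ENNReal.ofReal (Real.exp c) * μ {ω | c ≤ U ω}) := by
        rw [← mul_assoc, h1, one_mul]
    _ ≤ ENNReal.ofReal (Real.exp (-c)) * ENNReal.ofReal a := by gcongr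
    _ = ENNReal.ofReal (a * Real.exp (-c)) := by
        rw [← ENNReal.ofReal_mul (Real.exp_pos _).le, mul_comm]

section Pi

variable {Z : Type*} [MeasurableSpace Z] {μ : Measure Z} [IsProbabilityMeasure μ]

theorem lintegral_pi_prod (n : ℕ) {f : Z → ℝ≥0∞} (hf : Measurable f) :
    ∫⁻ s, ∏ i, f (s i) ∂(Measure.pi fun _ : Fin n => μ) = (∫⁻ z, f z ∂μ) ^ n := by
  rw [ProbabilityTheory.lintegral_prod_eq_prod_lintegral_of_indepFun Finset.univ
    (fun i (s : Fin n → Z) => f (s i))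
    (ProbabilityTheory.iIndepFun_pi (X := fun _ => f) fun _ => hf.aemeasurable)
    (fun i => hf.comp (measurable_pi_apply i))]
  have : ∀ i : Fin n, ∫⁻ s, f (s i) ∂(Measure.pi fun _ : Fin n => μ) = ∫⁻ z, f z ∂μ := fun i =>
    (measurePreserving_eval (fun _ : Fin n => μ) i).lintegral_comp hf
  simp [this]

/-- Conditionally on the example with index `j`, the other ones are still i.i.d.; so a product of
factors that depend on that example keeps the bound that each factor satisfies. -/
theorem lintegral_pi_prod_succAbove_le_one (n : ℕ) (j : Fin (n + 1)) {f : Z → Z → ℝ≥0∞}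
    (hf : Measurable (Function.uncurry f)) (h1 : ∀ w, ∫⁻ z, f w z ∂μ ≤ 1) :
    ∫⁻ s, ∏ i, f (s j) (s (j.succAbove i)) ∂(Measure.pi fun _ : Fin (n + 1) => μ) ≤ 1 := by
  have hF : Measurable fun q : Z × (Fin n → Z) => ∏ i, f q.1 (q.2 i) := by
    refine Finset.measurable_prod _ fun i _ => ?_
    exact hf.comp (measurable_fst.prodMk ((measurable_pi_apply i).comp measurable_snd))
  have hmp := measurePreserving_piFinSuccAbove (fun _ : Fin (n + 1) => μ) j
  have := hmp.lintegral_comp hF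
  calc ∫⁻ s, ∏ i, f (s j) (s (j.succAbove i)) ∂(Measure.pi fun _ : Fin (n + 1) => μ)
      = ∫⁻ q, ∏ i, f q.1 (q.2 i) ∂(μ.prod (Measure.pi fun _ : Fin n => μ)) := this
    _ = ∫⁻ w, ∫⁻ s, ∏ i, f w (s i) ∂(Measure.pi fun _ : Fin n => μ) ∂μ :=
        lintegral_prod _ hF.aemeasurable
    _ = ∫⁻ w, (∫⁻ z, f w z ∂μ) ^ n ∂μ := by
        refine lintegral_congr fun w => lintegral_pi_prod n ?_
        exact hf.comp (measurable_const.prodMk measurable_id)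
    _ ≤ ∫⁻ _, 1 ∂μ := lintegral_mono fun w => pow_le_one' (h1 w) n
    _ = 1 := by simp

open Classical in
/-- Chernoff's lower tail for the number of examples in a set whose mean is at least `2 k`. -/
theorem pi_card_lt_le (n k : ℕ) {B : Set Z} (hB : MeasurableSet B)
    (hk : 2 * (k : ℝ) ≤ n * μ.real B) :
    (Measure.pi fun _ : Fin n => μ) {s | (∑ i, if s i ∈ B then (1 : ℝ) else 0) ≤ k} ≤
      ENNReal.ofReal (Real.exp (-(k / 4))) := by
  set p := μ.real B with hp
  -- The factor `exp (h z)` is `1 / 2` on `B` and `1` elsewhere.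
  set h : Z → ℝ := fun z => -(Real.log 2 * if z ∈ B then (1 : ℝ) else 0) with hh
  have hhm : Measurable h :=
    ((Measurable.ite hB measurable_const measurable_const).const_mul _).neg
  have hfac : ∫⁻ z, ENNReal.ofReal (Real.exp (h z)) ∂μ ≤ ENNReal.ofReal (Real.exp (-p / 2)) := by
    have hpt : ∀ z, Real.exp (h z) = 1 - B.indicator (fun _ => (1 / 2 : ℝ)) z := by
      intro z
      by_cases hz : z ∈ B
      · simp only [hh, hz, if_true, Set.indicator_of_mem, mul_one, Real.exp_neg,
          Real.exp_log two_pos]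
        norm_num
      · simp [hh, hz]
    have hint : Integrable (fun z => 1 - B.indicator (fun _ => (1 / 2 : ℝ)) z) μ :=
      (integrable_const _).sub ((integrable_const _).indicator hB)
    simp_rw [hpt]
    rw [← ofReal_integral_eq_lintegral_ofReal hint
      (Filter.Eventually.of_forall fun z => (Real.exp_pos (h z)).le.trans_eq (hpt z))]
    refine ENNReal.ofReal_le_ofReal ?_
    rw [integral_sub (integrable_const _) ((integrable_const _).indicator hB),
      integral_indicator_const _ hB]
    have := Real.add_one_le_exp (-p / 2)
    simp only [integral_const, probReal_univ, smul_eq_mul, ← hp]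
    linarith
  have hU : Measurable fun s : Fin n → Z => ∑ i, h (s i) :=
    Finset.measurable_sum _ fun i _ => hhm.comp (measurable_pi_apply i)
  have hexp : ∫⁻ s, ENNReal.ofReal (Real.exp (∑ i, h (s i))) ∂(Measure.pi fun _ : Fin n => μ) ≤
      ENNReal.ofReal (Real.exp (n * (-p / 2))) := by
    simp_rw [Real.exp_sum, ENNReal.ofReal_prod_of_nonneg fun _ _ => (Real.exp_pos _).le]
    rw [lintegral_pi_prod n (f := fun z => ENNReal.ofReal (Real.exp (h z))) (by fun_prop),
      Real.exp_nat_mul, ENNReal.ofReal_pow (Real.exp_pos _).le]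
    gcongr
  refine le_trans (measure_mono ?_)
    ((measure_le_of_lintegral_exp_le hU hexp (-(Real.log 2 * k))).trans
      (ENNReal.ofReal_le_ofReal ?_))
  · intro s hs
    simp only [Set.mem_ofPred_eq, hh, Finset.sum_neg_distrib, ← Finset.mul_sum] at hs ⊢
    have := Real.log_pos one_lt_two
    gcongr
  · rw [← Real.exp_add]
    refine Real.exp_le_exp.mpr ?_
    have := Real.log_two_lt_d9
    have hk0 : (0 : ℝ) ≤ k := Nat.cast_nonneg k
    nlinarith

end Pi

/-! ### Reliable neighbourhoods in a clean sample -/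

/-- Exponential moment of a centred Bernoulli variable of mean `p`. -/
theorem bernoulli_exp_moment_le {p t : ℝ} (hp : p ∈ Set.Icc (0 : ℝ) 1) (ht : |t| ≤ 1) :
    p * Real.exp (t * (1 - p) - t ^ 2) + (1 - p) * Real.exp (t * (0 - p) - t ^ 2) ≤ 1 := by
  obtain ⟨hp0, hp1⟩ := hp
  have key : ∀ u : ℝ, |u| ≤ 1 → Real.exp u ≤ 1 + u + u ^ 2 := fun u hu => by
    linarith [(abs_le.mp (Real.abs_exp_sub_one_sub_id_le hu)).2]
  have h1 := key (t * (1 - p)) (by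
    rw [abs_mul, abs_of_nonneg (by linarith : 0 ≤ 1 - p)]
    exact mul_le_one₀ ht (by linarith) (by linarith))
  have h0 := key (t * (0 - p)) (by
    rw [abs_mul, zero_sub, abs_neg, abs_of_nonneg hp0]
    exact mul_le_one₀ ht hp0 hp1)
  have hsum : p * Real.exp (t * (1 - p)) + (1 - p) * Real.exp (t * (0 - p)) ≤ 1 + t ^ 2 := by
    have e1 := mul_le_mul_of_nonneg_left h1 hp0
    have e0 := mul_le_mul_of_nonneg_left h0 (by linarith : 0 ≤ 1 - p)
    have : t ^ 2 * (p * (1 - p)) ≤ t ^ 2 * 1 :=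
      mul_le_mul_of_nonneg_left (by nlinarith) (sq_nonneg t)
    nlinarith
  have hexp : Real.exp (t ^ 2) * Real.exp (-t ^ 2) = 1 := by
    rw [← Real.exp_add]; simp
  have h2 : 1 + t ^ 2 ≤ Real.exp (t ^ 2) := by linarith [Real.add_one_le_exp (t ^ 2)]
  rw [sub_eq_add_neg, Real.exp_add, sub_eq_add_neg (t * (0 - p)), Real.exp_add]
  calc _ = (p * Real.exp (t * (1 - p)) + (1 - p) * Real.exp (t * (0 - p))) *
        Real.exp (-t ^ 2) := by ring
    _ ≤ Real.exp (t ^ 2) * Real.exp (-t ^ 2) :=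
        mul_le_mul_of_nonneg_right (hsum.trans h2) (Real.exp_pos _).le
    _ = 1 := hexp

section Reliable

variable {M : Type*} [MetricSpace M]

/-- The label of an example as a real number. -/
def labelValue (y : Fin 2) : ℝ := if y = 1 then 1 else 0

theorem measurable_labelValue : Measurable labelValue := measurable_of_finite _

open Classical in
/-- The number of examples in the closed ball of radius `r` about `x`. -/
noncomputable def ballCount {n : ℕ} (r : ℝ) (s : Fin n → M × Fin 2) (x : M) : ℝ :=
  ∑ i, if dist (s i).1 x ≤ r then 1 else 0

open Classical in
/-- The number of examples other than the `j`-th one that are at most as far from `x` as it is. -/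
noncomputable def closerCount {n : ℕ} (s : Fin n → M × Fin 2) (j : Fin n) (x : M) : ℝ :=
  ∑ i, if i ≠ j ∧ dist (s i).1 x ≤ dist (s j).1 x then 1 else 0

open Classical in
/-- The sum of the centred labels `yᵢ - η xᵢ` of the examples counted by `closerCount`. -/
noncomputable def closerNoise {n : ℕ} (η : M → ℝ) (s : Fin n → M × Fin 2) (j : Fin n) (x : M) :
    ℝ :=
  ∑ i, if i ≠ j ∧ dist (s i).1 x ≤ dist (s j).1 x then labelValue (s i).2 - η (s i).1 else 0

/-- The point `x` is reliable at scale `k` for the sample `s`, with radius `r` and confidence `T`: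
the ball of radius `r` about `x` holds more than `k` examples, and the label noise in each closed
ball about `x` that has an example on its boundary, apart from that example, is small. -/
def Reliable {n : ℕ} (η : M → ℝ) (r T : ℝ) (k : ℕ) (s : Fin n → M × Fin 2) (x : M) : Prop :=
  k < ballCount r s x ∧
    ∀ j, √(T / k) * |closerNoise η s j x| < T / k * closerCount s j x + T

variable [MeasurableSpace M] [BorelSpace M] {η : M → ℝ} {P : Measure M} [IsProbabilityMeasure P]

theorem pi_ballCount_le (n k : ℕ) (hη : Measurable η) (hη01 : ∀ x, η x ∈ Set.Icc (0 : ℝ) 1)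
    (x : M) {r : ℝ} (hk : 2 * (k : ℝ) ≤ n * P.real (Metric.closedBall x r)) :
    (Measure.pi fun _ : Fin n => jointLaw P η) {s | ballCount r s x ≤ k} ≤
      ENNReal.ofReal (Real.exp (-(k / 4))) := by
  have := isProbabilityMeasure_jointLaw (P := P) hη hη01
  have hB : MeasurableSet (Metric.closedBall x r) := Metric.isClosed_closedBall.measurableSet
  refine pi_card_lt_le n k (measurable_fst (β := Fin 2) hB) ?_
  rwa [measureReal_def, jointLaw_preimage_fst hη hη01 hB]

variable [SecondCountableTopology M]

theorem measurable_ballCount (n : ℕ) (r : ℝ) :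
    Measurable fun q : (Fin n → M × Fin 2) × M => ballCount r q.1 q.2 := by
  unfold ballCount
  refine Finset.measurable_sum _ fun i _ => Measurable.ite ?_ measurable_const measurable_const
  exact measurableSet_le (by fun_prop) measurable_const

theorem measurableSet_closer {n : ℕ} (i j : Fin n) :
    MeasurableSet {q : (Fin n → M × Fin 2) × M |
      i ≠ j ∧ dist (q.1 i).1 q.2 ≤ dist (q.1 j).1 q.2} :=
  (MeasurableSet.const (i ≠ j)).inter (measurableSet_le
    (f := fun q : (Fin n → M × Fin 2) × M => dist (q.1 i).1 q.2)
    (g := fun q : (Fin n → M × Fin 2) × M => dist (q.1 j).1 q.2) (by fun_prop) (by fun_prop))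

theorem measurable_closerCount {n : ℕ} (j : Fin n) :
    Measurable fun q : (Fin n → M × Fin 2) × M => closerCount q.1 j q.2 := by
  unfold closerCount
  exact Finset.measurable_sum _ fun i _ =>
    Measurable.ite (measurableSet_closer i j) measurable_const measurable_const

theorem measurable_closerNoise {n : ℕ} (hη : Measurable η) (j : Fin n) :
    Measurable fun q : (Fin n → M × Fin 2) × M => closerNoise η q.1 j q.2 := by
  unfold closerNoise
  have := measurable_labelValue
  exact Finset.measurable_sum _ fun i _ =>
    Measurable.ite (measurableSet_closer i j) (by fun_prop) measurable_const

theorem measurableSet_reliable (n : ℕ) (hη : Measurable η) (r T : ℝ) (k : ℕ) :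
    MeasurableSet {q : (Fin n → M × Fin 2) × M | Reliable η r T k q.1 q.2} := by
  have hN := fun j : Fin n => measurable_closerNoise (M := M) hη j
  have hC := fun j : Fin n => measurable_closerCount (M := M) j
  refine (measurableSet_lt measurable_const (measurable_ballCount n r)).inter ?_
  show MeasurableSet {q : (Fin n → M × Fin 2) × M |
    ∀ j, √(T / k) * |closerNoise η q.1 j q.2| < T / k * closerCount q.1 j q.2 + T}
  rw [Set.ofPred_forall]
  refine MeasurableSet.iInter fun j => measurableSet_lt ?_ ?_
  · have := hN j
    fun_prop
  · have := hC j
    fun_prop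

/-- The exponential moment of the label noise closer to `x` than the example `j`: conditionally on
the example `j` and on the positions, the other labels are independent Bernoulli variables. -/
theorem pi_closerNoise_le (n : ℕ) (hη : Measurable η) (hη01 : ∀ x, η x ∈ Set.Icc (0 : ℝ) 1)
    (j : Fin n) (x : M) {t : ℝ} (ht : |t| ≤ 1) (T : ℝ) :
    (Measure.pi fun _ : Fin n => jointLaw P η)
        {s | T ≤ t * closerNoise η s j x - t ^ 2 * closerCount s j x} ≤
      ENNReal.ofReal (Real.exp (-T)) := by
  classical
  have := isProbabilityMeasure_jointLaw (P := P) hη hη01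
  obtain ⟨n, rfl⟩ : ∃ m, n = m + 1 := ⟨n - 1, by have := j.pos; omega⟩
  have hlv := measurable_labelValue
  have hU : Measurable fun s : Fin (n + 1) → M × Fin 2 =>
      t * closerNoise η s j x - t ^ 2 * closerCount s j x := by
    have h1 : Measurable fun s : Fin (n + 1) → M × Fin 2 => closerNoise η s j x :=
      (measurable_closerNoise hη j).comp (measurable_id.prodMk measurable_const)
    have h2 : Measurable fun s : Fin (n + 1) → M × Fin 2 => closerCount s j x :=
      (measurable_closerCount j).comp (measurable_id.prodMk measurable_const)
    fun_prop
  set h : M × Fin 2 → M × Fin 2 → ℝ := fun w z =>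
    if dist z.1 x ≤ dist w.1 x then t * (labelValue z.2 - η z.1) - t ^ 2 else 0 with hh
  have hhm : Measurable (Function.uncurry h) :=
    Measurable.ite (measurableSet_le (by fun_prop) (by fun_prop)) (by fun_prop) measurable_const
  have hhm' : Measurable (Function.uncurry fun w z => ENNReal.ofReal (Real.exp (h w z))) :=
    ENNReal.measurable_ofReal.comp (Real.measurable_exp.comp hhm)
  have hfac : ∀ w, ∫⁻ z, ENNReal.ofReal (Real.exp (h w z)) ∂(jointLaw P η) ≤ 1 := by
    intro w
    rw [lintegral_jointLaw hη (f := fun z => ENNReal.ofReal (Real.exp (h w z)))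
      (hhm'.comp (measurable_const.prodMk measurable_id))]
    calc _ ≤ ∫⁻ _, 1 ∂P := lintegral_mono fun y => ?_
      _ = 1 := by simp
    obtain ⟨h0, h1⟩ := hη01 y
    show ENNReal.ofReal (η y) * ENNReal.ofReal (Real.exp (h w (y, 1))) +
      ENNReal.ofReal (1 - η y) * ENNReal.ofReal (Real.exp (h w (y, 0))) ≤ 1
    have h1' : 0 ≤ 1 - η y := by linarith
    rw [← ENNReal.ofReal_mul h0, ← ENNReal.ofReal_mul h1', ← ENNReal.ofReal_add
      (mul_nonneg h0 (Real.exp_pos _).le) (mul_nonneg h1' (Real.exp_pos _).le),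
      ← ENNReal.ofReal_one]
    refine ENNReal.ofReal_le_ofReal ?_
    by_cases hd : dist y x ≤ dist w.1 x
    · simpa [hh, hd, labelValue] using bernoulli_exp_moment_le ⟨h0, h1⟩ ht
    · simp [hh, hd]
  have hsplit : ∀ s : Fin (n + 1) → M × Fin 2,
      t * closerNoise η s j x - t ^ 2 * closerCount s j x =
        ∑ i, h (s j) (s (j.succAbove i)) := by
    intro s
    simp only [closerNoise, closerCount, Finset.mul_sum, ← Finset.sum_sub_distrib]
    rw [Fin.sum_univ_succAbove _ j]
    simp only [ne_eq, not_true_eq_false, false_and, if_false, mul_zero, sub_zero, zero_add]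
    refine Finset.sum_congr rfl fun i _ => ?_
    by_cases hd : dist (s (j.succAbove i)).1 x ≤ dist (s j).1 x <;>
      simp [hh, hd, Fin.succAbove_ne]
  have hexp : ∫⁻ s, ENNReal.ofReal (Real.exp
      (t * closerNoise η s j x - t ^ 2 * closerCount s j x))
        ∂(Measure.pi fun _ : Fin (n + 1) => jointLaw P η) ≤ ENNReal.ofReal 1 := by
    simp_rw [hsplit, Real.exp_sum, ENNReal.ofReal_prod_of_nonneg fun _ _ => (Real.exp_pos _).le]
    rw [ENNReal.ofReal_one]
    exact lintegral_pi_prod_succAbove_le_one n j hhm' hfac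
  simpa using measure_le_of_lintegral_exp_le hU hexp T

/-- A fixed point is reliable with high probability. -/
theorem pi_not_reliable_le (n : ℕ) (hη : Measurable η) (hη01 : ∀ x, η x ∈ Set.Icc (0 : ℝ) 1)
    (x : M) {r T : ℝ} {k : ℕ} (hT : 0 < T) (hTk : T ≤ k)
    (hk : 2 * (k : ℝ) ≤ n * P.real (Metric.closedBall x r)) :
    (Measure.pi fun _ : Fin n => jointLaw P η) {s | ¬ Reliable η r T k s x} ≤
      ENNReal.ofReal ((2 * n + 1) * Real.exp (-(T / 4))) := by
  set μ := Measure.pi fun _ : Fin n => jointLaw P η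
  have hk0 : (0 : ℝ) < k := hT.trans_le hTk
  have hsq : √(T / k) ^ 2 = T / k := Real.sq_sqrt (by positivity)
  have ht1 : √(T / k) ≤ 1 := Real.sqrt_le_one.mpr ((div_le_one hk0).mpr hTk)
  have ht0 : 0 ≤ √(T / k) := Real.sqrt_nonneg _
  set t := √(T / k) with ht
  have hpos : ∀ j : Fin n, μ {s | T ≤ t * closerNoise η s j x - t ^ 2 * closerCount s j x} ≤
      ENNReal.ofReal (Real.exp (-(T / 4))) := fun j =>
    (pi_closerNoise_le n hη hη01 j x (abs_le.mpr ⟨by linarith, ht1⟩) T).trans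
      (ENNReal.ofReal_le_ofReal (Real.exp_le_exp.mpr (by linarith)))
  have hneg : ∀ j : Fin n,
      μ {s | T ≤ (-t) * closerNoise η s j x - (-t) ^ 2 * closerCount s j x} ≤
        ENNReal.ofReal (Real.exp (-(T / 4))) := fun j =>
    (pi_closerNoise_le n hη hη01 j x (abs_le.mpr ⟨by linarith, by linarith⟩) T).trans
      (ENNReal.ofReal_le_ofReal (Real.exp_le_exp.mpr (by linarith)))
  have hcount : μ {s | ballCount r s x ≤ k} ≤ ENNReal.ofReal (Real.exp (-(T / 4))) :=
    (pi_ballCount_le n k hη hη01 x hk).trans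
      (ENNReal.ofReal_le_ofReal (Real.exp_le_exp.mpr (by linarith)))
  have hsub : {s | ¬ Reliable η r T k s x} ⊆ {s : Fin n → M × Fin 2 | ballCount r s x ≤ k} ∪
      ⋃ j : Fin n, ({s | T ≤ t * closerNoise η s j x - t ^ 2 * closerCount s j x} ∪
        {s | T ≤ (-t) * closerNoise η s j x - (-t) ^ 2 * closerCount s j x}) := by
    intro s hs
    by_contra hcon
    simp only [Set.mem_union, Set.mem_iUnion, Set.mem_ofPred_eq, not_or, not_exists, not_le,
      neg_sq, hsq] at hcon
    refine hs ⟨hcon.1, fun j => ?_⟩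
    rw [← ht]
    obtain ⟨h1, h2⟩ := hcon.2 j
    rcases abs_cases (closerNoise η s j x) with ⟨he, _⟩ | ⟨he, _⟩ <;> rw [he] <;> linarith
  set e := Real.exp (-(T / 4))
  have he0 : 0 ≤ e := (Real.exp_pos _).le
  calc μ {s | ¬ Reliable η r T k s x}
      ≤ ENNReal.ofReal e + ∑ _j : Fin n, (ENNReal.ofReal e + ENNReal.ofReal e) := by
        refine (measure_mono hsub).trans ((measure_union_le _ _).trans (add_le_add hcount ?_))
        refine (measure_iUnion_fintype_le _ _).trans (Finset.sum_le_sum fun j _ => ?_)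
        exact (measure_union_le _ _).trans (add_le_add (hpos j) (hneg j))
    _ = ENNReal.ofReal ((2 * n + 1) * e) := by
        rw [← ENNReal.ofReal_add he0 he0, ← ENNReal.ofReal_sum_of_nonneg fun _ _ => by positivity,
          ← ENNReal.ofReal_add he0 (Finset.sum_nonneg fun _ _ => by positivity)]
        simp only [Finset.sum_const, Finset.card_univ, Fintype.card_fin, nsmul_eq_mul]
        ring_nf

/-- By Fubini and Markov, the set of unreliable points is small for most samples. This replaces a
bound that would be uniform over all points of the space. -/
theorem exists_event_reliable (n : ℕ) (hη : Measurable η) (hη01 : ∀ x, η x ∈ Set.Icc (0 : ℝ) 1)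
    (A : Finset ℕ) {r : ℕ → ℝ} {T ε : ℝ} (hε : 0 < ε) (hT : 0 < T) (hTA : ∀ k ∈ A, T ≤ k)
    (hA : ∀ k ∈ A, ∀ x, 2 * (k : ℝ) ≤ n * P.real (Metric.closedBall x (r k))) :
    ∃ G : Set (Fin n → M × Fin 2), MeasurableSet G ∧
      ENNReal.ofReal (1 - A.card * ((2 * n + 1) * Real.exp (-(T / 4))) / ε) ≤
        Measure.pi (fun _ : Fin n => jointLaw P η) G ∧
      ∀ s ∈ G, ∃ B : Set M, MeasurableSet B ∧ P.real B ≤ ε ∧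
        ∀ x ∉ B, ∀ k ∈ A, Reliable η (r k) T k s x := by
  have := isProbabilityMeasure_jointLaw (P := P) hη hη01
  set μ := Measure.pi fun _ : Fin n => jointLaw P η
  set b := (A.card : ℝ) * ((2 * n + 1) * Real.exp (-(T / 4))) with hb
  have hb0 : 0 ≤ b := by positivity
  set U : Set ((Fin n → M × Fin 2) × M) := ⋃ k ∈ A, {q | Reliable η (r k) T k q.1 q.2}ᶜ with hU
  have hUm : MeasurableSet U :=
    A.measurableSet_biUnion fun k _ => (measurableSet_reliable n hη (r k) T k).compl
  have hsec : ∀ x, μ ((fun s => (s, x)) ⁻¹' U) ≤ ENNReal.ofReal b := by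
    intro x
    have : (fun s => (s, x)) ⁻¹' U = ⋃ k ∈ A, {s | ¬ Reliable η (r k) T k s x} := by
      ext s; simp [hU]
    rw [this]
    refine (measure_biUnion_finset_le _ _).trans ((Finset.sum_le_sum fun k hk =>
      pi_not_reliable_le n hη hη01 x hT (hTA k hk) (hA k hk x)).trans ?_)
    rw [← ENNReal.ofReal_sum_of_nonneg fun _ _ => by positivity]
    simp [hb]
  have htot : ∫⁻ s, P (Prod.mk s ⁻¹' U) ∂μ ≤ ENNReal.ofReal b := by
    rw [← Measure.prod_apply hUm, Measure.prod_apply_symm hUm]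
    calc _ ≤ ∫⁻ _, ENNReal.ofReal b ∂P := lintegral_mono hsec
      _ = ENNReal.ofReal b := by simp
  have hPm : Measurable fun s => P (Prod.mk s ⁻¹' U) := measurable_measure_prodMk_left hUm
  refine ⟨{s | ENNReal.ofReal ε ≤ P (Prod.mk s ⁻¹' U)}ᶜ,
    (measurableSet_le measurable_const hPm).compl, ?_, fun s hs => ⟨Prod.mk s ⁻¹' U, ?_, ?_, ?_⟩⟩
  · have hmk : μ {s | ENNReal.ofReal ε ≤ P (Prod.mk s ⁻¹' U)} ≤ ENNReal.ofReal (b / ε) := by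
      rw [ENNReal.ofReal_div_of_pos hε]
      refine (ENNReal.le_div_iff_mul_le (Or.inl (by simpa using hε)) (Or.inl (by simp))).mpr ?_
      rw [mul_comm]
      exact (mul_meas_ge_le_lintegral hPm _).trans htot
    rw [prob_compl_eq_one_sub (measurableSet_le measurable_const hPm), ENNReal.ofReal_sub _
      (by positivity), ENNReal.ofReal_one]
    exact tsub_le_tsub_left hmk 1
  · exact measurable_prodMk_left hUm
  · simp only [Set.mem_compl_iff, Set.mem_ofPred_eq, not_le] at hs
    exact ENNReal.toReal_le_of_le_ofReal hε.le hs.le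
  · intro x hx k hk
    by_contra hcon
    exact hx (Set.mem_biUnion hk hcon)

end Reliable

/-! ### The nearest-neighbour rule at a reliable point -/

section NearestNeighbours

variable {M ι : Type*} [MetricSpace M] [Fintype ι]

/-- The infimum that defines the `k`-NN radius is attained, because the sample is finite. -/
theorem le_card_knnSet {k : ℕ} {z : ι → M × Fin 2} {x : M} (h : knnRadius k z x < ⊤) :
    k ≤ (knnSet k z x).card := by
  classical
  set ρ := knnRadius k z x with hρ
  -- `m` is the distance of the nearest example outside the closed ball of radius `ρ`.
  obtain ⟨m, hm, hlt⟩ : ∃ m : ℝ≥0∞, ρ < m ∧ ∀ i, ρ < edist (z i).1 x → m ≤ edist (z i).1 x := by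
    refine ⟨(Finset.univ.filter fun i => ρ < edist (z i).1 x).inf fun i => edist (z i).1 x, ?_,
      fun i hi => Finset.inf_le (by simpa using hi)⟩
    rw [Finset.lt_inf_iff h]
    intro i hi
    simpa using hi
  obtain ⟨r, hr, hrm⟩ := sInf_lt_iff.mp (hρ ▸ hm : sInf _ < m)
  refine (show k ≤ Nat.card {i // edist (z i).1 x ≤ r} from hr).trans ?_
  rw [Nat.card_eq_fintype_card, Fintype.card_subtype]
  refine Finset.card_le_card fun i hi => ?_
  simp only [knnSet, Finset.mem_filter, Finset.mem_univ, true_and] at hi ⊢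
  by_contra hcon
  exact absurd (hi.trans_lt hrm) (not_lt.mpr (hlt i (not_le.mp hcon)))

/-- The prediction of a `k`-NN classifier is the majority label of the `k`-NN set. -/
theorem IsKNNClassifier.majority [MeasurableSpace M] {k : ℕ} {z : ι → M × Fin 2} {g : M → Fin 2}
    (hg : IsKNNClassifier k z g) (x : M) :
    (g x = 1 → ((knnSet k z x).card : ℝ) / 2 ≤ ∑ i ∈ knnSet k z x, labelValue (z i).2) ∧
      (g x = 0 → ∑ i ∈ knnSet k z x, labelValue (z i).2 ≤ ((knnSet k z x).card : ℝ) / 2) := by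
  classical
  set A := knnSet k z x with hA
  rcases A.eq_empty_or_nonempty with he | hne
  · simp [he]
  have hN : (0 : ℝ) < A.card := by exact_mod_cast hne.card_pos
  have h1 : ∑ i, (if (z i).2 = 1 ∧ i ∈ A then (1 : ℝ) else 0) = ∑ i ∈ A, labelValue (z i).2 := by
    simp [labelValue, ite_and, and_comm]
  have h0 : ∑ i, (if (z i).2 = 0 ∧ i ∈ A then (1 : ℝ) else 0) =
      A.card - ∑ i ∈ A, labelValue (z i).2 := by
    have hpt : ∀ i, 1 - labelValue (z i).2 = if (z i).2 = 0 then 1 else 0 := by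
      intro i
      rcases Fin.exists_fin_two.mp ⟨(z i).2, rfl⟩ with h | h <;> simp [h, labelValue]
    rw [← nsmul_one A.card, ← Finset.sum_const, ← Finset.sum_sub_distrib]
    simp [hpt, ite_and, and_comm]
  have hs1 : knnScore k z 1 x = 1 / A.card * ∑ i ∈ A, labelValue (z i).2 := by
    rw [← h1]; rfl
  have hs0 : knnScore k z 0 x = 1 / A.card * (A.card - ∑ i ∈ A, labelValue (z i).2) := by
    rw [← h0]; rfl
  have hN' : (0 : ℝ) < 1 / A.card := by positivity
  constructor <;> intro hgx
  · have := hg.2 x 0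
    rw [hgx, hs1, hs0] at this
    linarith [le_of_mul_le_mul_left this hN']
  · have := hg.2 x 1
    rw [hgx, hs1, hs0] at this
    linarith [le_of_mul_le_mul_left this hN']

end NearestNeighbours

section Pointwise

variable {M : Type*} [MetricSpace M] {η : M → ℝ} {n k : ℕ} {r T : ℝ} {s : Fin n → M × Fin 2}
  {x : M}

theorem abs_labelValue_sub_le {p : ℝ} (hp : p ∈ Set.Icc (0 : ℝ) 1) (y : Fin 2) :
    |labelValue y - p| ≤ 1 := by
  obtain ⟨h0, h1⟩ := hp
  unfold labelValue
  split_ifs <;> exact abs_le.mpr ⟨by linarith, by linarith⟩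

/-- At a reliable point the label noise is small in every ball: only the farthest example in the
ball matters, and `closerNoise` leaves out nothing but that example. -/
theorem Reliable.abs_noise_le (h : Reliable η r T k s x) (hη01 : ∀ x, η x ∈ Set.Icc (0 : ℝ) 1)
    (hT : 0 < T) (hk : 0 < k) {A : Finset (Fin n)} {ρ : ℝ≥0∞}
    (hA : ∀ i, i ∈ A ↔ edist (s i).1 x ≤ ρ) :
    |∑ i ∈ A, (labelValue (s i).2 - η (s i).1)| ≤ √(T / k) * (A.card + k) + 1 := by
  classical
  rcases A.eq_empty_or_nonempty with rfl | hne
  · simp only [Finset.sum_empty, abs_zero]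
    positivity
  obtain ⟨j, hj, hmax⟩ := A.exists_max_image (fun i => dist (s i).1 x) hne
  have hmem : ∀ i, dist (s i).1 x ≤ dist (s j).1 x ↔ i ∈ A := by
    refine fun i => ⟨fun hi => ?_, hmax i⟩
    rw [hA] at hj ⊢
    refine le_trans ?_ hj
    rw [edist_dist, edist_dist]
    exact ENNReal.ofReal_le_ofReal hi
  have hfilter : Finset.univ.filter (fun i => i ≠ j ∧ dist (s i).1 x ≤ dist (s j).1 x) =
      A.erase j := by
    ext i
    simp [hmem]
  have hnoise : ∑ i ∈ A, (labelValue (s i).2 - η (s i).1) =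
      closerNoise η s j x + (labelValue (s j).2 - η (s j).1) := by
    rw [closerNoise, ← Finset.sum_filter, hfilter, Finset.sum_erase_add _ _ hj]
  have hcount : closerCount s j x ≤ A.card := by
    rw [closerCount, ← Finset.sum_filter, hfilter]
    simp only [Finset.sum_const, nsmul_eq_mul, mul_one]
    exact_mod_cast Finset.card_le_card (Finset.erase_subset j A)
  have hk0 : (0 : ℝ) < k := by exact_mod_cast hk
  have ht : 0 < √(T / k) := Real.sqrt_pos.mpr (by positivity)
  have hsq : √(T / k) * √(T / k) = T / k := Real.mul_self_sqrt (by positivity)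
  have hTk : T = √(T / k) * √(T / k) * k := by rw [hsq]; field_simp
  have hlt := h.2 j
  have hbound : |closerNoise η s j x| ≤ √(T / k) * (A.card + k) := by
    refine le_of_mul_le_mul_left (hlt.le.trans ?_) ht
    calc T / k * closerCount s j x + T ≤ T / k * A.card + T := by gcongr
      _ = √(T / k) * (√(T / k) * (A.card + k)) := by
        linear_combination hTk - (A.card : ℝ) * hsq
  rw [hnoise]
  exact (abs_add_le _ _).trans (add_le_add hbound (abs_labelValue_sub_le (hη01 _) _))

/-- At a reliable point, a `k`-NN classifier can only err if the margin is small. The corrupted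
points contribute at most one neighbour, because they are too far apart. -/
theorem Reliable.margin_le [MeasurableSpace M] (h : Reliable η r T k s x)
    (hη01 : ∀ x, η x ∈ Set.Icc (0 : ℝ) 1) (hT : 1 ≤ T) (hk : 0 < k) (hr : 0 ≤ r)
    {C : Finset M} (hC : ∀ c ∈ C, ∀ c' ∈ C, c ≠ c' → 2 * r < dist c c')
    {b : ℝ} (hb : ∀ y, dist y x ≤ r → |η y - η x| ≤ b)
    {ℓ : M → Fin 2} {g : M → Fin 2} (hg : IsKNNClassifier k (corruptedSample s C ℓ) g)
    (hne : g x ≠ bayes η x) : |1 / 2 - η x| ≤ 4 * √(T / k) + b := by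
  classical
  set z := corruptedSample s C ℓ with hz
  set A := knnSet k z x with hA
  have hmem : ∀ i, i ∈ A ↔ edist (z i).1 x ≤ knnRadius k z x := by
    intro i; simp [hA, knnSet]
  -- The clean examples alone already fill the ball of radius `r`.
  have hrad : knnRadius k z x ≤ ENNReal.ofReal r := by
    refine sInf_le ?_
    show k ≤ Nat.card {i // edist (z i).1 x ≤ ENNReal.ofReal r}
    have h1 := h.1
    simp only [ballCount, ← Finset.sum_filter, Finset.sum_const, nsmul_eq_mul, mul_one,
      Nat.cast_lt] at h1
    rw [Nat.card_eq_fintype_card, Fintype.card_subtype]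
    refine h1.le.trans (Finset.card_le_card_of_injOn Sum.inl ?_ Sum.inl_injective.injOn)
    intro i hi
    simp only [Finset.coe_filter, Finset.mem_univ, true_and, Set.mem_ofPred_eq] at hi ⊢
    rw [edist_dist]
    exact ENNReal.ofReal_le_ofReal hi
  have hdist : ∀ i ∈ A, dist (z i).1 x ≤ r := by
    intro i hi
    have := ((hmem i).mp hi).trans hrad
    rwa [edist_dist, ENNReal.ofReal_le_ofReal_iff hr] at this
  have hcard : k ≤ A.card := le_card_knnSet (hrad.trans_lt ENNReal.ofReal_lt_top)
  set A₁ : Finset (Fin n) := Finset.univ.filter fun i => Sum.inl i ∈ A with hA₁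
  set A₂ : Finset C := Finset.univ.filter fun c => Sum.inr c ∈ A with hA₂
  have hsplit : ∀ f : Fin n ⊕ C → ℝ,
      ∑ i ∈ A, f i = ∑ i ∈ A₁, f (Sum.inl i) + ∑ c ∈ A₂, f (Sum.inr c) := by
    intro f
    rw [Finset.sum_filter, Finset.sum_filter, ← Fintype.sum_sum_type
      (fun i => if i ∈ A then f i else 0), ← Finset.sum_filter]
    simp
  have hA₂card : (A₂.card : ℝ) ≤ 1 := by
    have : A₂.card ≤ 1 := by
      refine Finset.card_le_one.mpr fun c hc c' hc' => ?_
      by_contra hcc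
      have d := hdist _ (Finset.mem_filter.mp hc).2
      have d' := hdist _ (Finset.mem_filter.mp hc').2
      have hlt := hC c.1 c.2 c'.1 c'.2 fun e => hcc (Subtype.ext e)
      have htri := dist_triangle_right c.1 c'.1 x
      have d1 : dist c.1 x ≤ r := d
      have d2 : dist c'.1 x ≤ r := d'
      linarith
    exact_mod_cast this
  have hNsum : (A.card : ℝ) = A₁.card + A₂.card := by simpa using hsplit fun _ => 1
  set N := (A.card : ℝ) with hN
  have hkN : (k : ℝ) ≤ N := Nat.cast_le.mpr hcard
  have hk0 : (0 : ℝ) < k := by exact_mod_cast hk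
  have hk1 : (1 : ℝ) ≤ k := by exact_mod_cast hk
  set t := √(T / k) with ht
  have ht0 : 0 ≤ t := Real.sqrt_nonneg _
  have htk : 1 ≤ t * k := by
    have : √(T / k) * k = √(T * k) := by
      rw [show T * k = T / k * (k * k) by field_simp, Real.sqrt_mul (by positivity),
        Real.sqrt_mul_self hk0.le]
    rw [ht, this]
    exact Real.one_le_sqrt.mpr (by nlinarith)
  have htN : t * k ≤ t * N := by gcongr
  have hb0 : 0 ≤ b := (abs_nonneg _).trans (hb x (by simpa using hr))
  set S := ∑ i ∈ A, labelValue (z i).2 with hS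
  have hdev : |S - N * η x| ≤ N * (4 * t + b) := by
    have hsum : S - N * η x = ∑ i ∈ A₁, (labelValue (s i).2 - η (s i).1) +
        ∑ i ∈ A₁, (η (s i).1 - η x) + ∑ c ∈ A₂, (labelValue (z (Sum.inr c)).2 - η x) := by
      have h1 : S - N * η x = ∑ i ∈ A, (labelValue (z i).2 - η x) := by
        simp [Finset.sum_sub_distrib, hS, hN]
      rw [h1, hsplit, ← Finset.sum_add_distrib]
      congr 1
      exact Finset.sum_congr rfl fun i _ => by
        show labelValue (s i).2 - η x = _
        ring
    have e1 := h.abs_noise_le hη01 (by linarith) hk (A := A₁) (ρ := knnRadius k z x)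
      (fun i => by rw [← show (z (Sum.inl i)).1 = (s i).1 from rfl, ← hmem]; simp [hA₁])
    have e2 : |∑ i ∈ A₁, (η (s i).1 - η x)| ≤ A₁.card * b := by
      refine (Finset.abs_sum_le_sum_abs _ _).trans ?_
      rw [← nsmul_eq_mul]
      exact Finset.sum_le_card_nsmul _ _ _ fun i hi =>
        hb _ (hdist _ (Finset.mem_filter.mp hi).2)
    have e3 : |∑ c ∈ A₂, (labelValue (z (Sum.inr c)).2 - η x)| ≤ 1 := by
      refine (Finset.abs_sum_le_sum_abs _ _).trans (le_trans ?_ hA₂card)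
      rw [← mul_one (A₂.card : ℝ), ← nsmul_eq_mul]
      exact Finset.sum_le_card_nsmul _ _ _ fun c _ => abs_labelValue_sub_le (hη01 x) _
    have hA₁N : (A₁.card : ℝ) ≤ N := by
      rw [hNsum]; linarith [(Nat.cast_nonneg A₂.card : (0 : ℝ) ≤ A₂.card)]
    have e2' : A₁.card * b ≤ N * b := by gcongr
    have e1' : t * (A₁.card + k) ≤ t * (N + N) := by gcongr
    rw [hsum]
    refine (abs_add_three _ _ _).trans ?_
    linarith
  have hN0 : 0 < N := hk0.trans_le hkN
  obtain ⟨hg1, hg0⟩ := hg.majority x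
  obtain ⟨hl, hu⟩ := abs_le.mp hdev
  rcases Fin.exists_fin_two.mp ⟨g x, rfl⟩ with hgx | hgx
  · have hmaj := hg0 hgx
    have hηx : 1 / 2 ≤ η x := by
      by_contra hcon
      exact hne (by rw [hgx, bayes, if_neg hcon])
    rw [abs_of_nonpos (by linarith)]
    refine le_of_mul_le_mul_left ?_ hN0
    linarith
  · have hmaj := hg1 hgx
    have hηx : ¬ 1 / 2 ≤ η x := fun hcon => hne (by rw [hgx, bayes, if_pos hcon])
    rw [abs_of_nonneg (by linarith)]
    refine le_of_mul_le_mul_left ?_ hN0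
    linarith

end Pointwise

/-! ### Disagreement with the Bayes classifier and excess risk -/

section Excess

variable {M : Type*} [MeasurableSpace M] {P : Measure M} [IsProbabilityMeasure P] {η : M → ℝ}

/-- If outside a set `B` the classifier only errs where the margin is below `τ`, then both the
disagreement with the Bayes classifier and the excess risk are controlled by `B` and by the region
of small margin. -/
theorem disagreement_and_excess_le (hη : Measurable η) (hη01 : ∀ x, η x ∈ Set.Icc (0 : ℝ) 1)
    {g : M → Fin 2} (hg : Measurable g) {B : Set M} (hB : MeasurableSet B) {τ : ℝ} (hτ : 0 < τ)
    (h : ∀ x ∉ B, g x ≠ bayes η x → |1 / 2 - η x| ≤ τ / 2) :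
    P.real {x | g x ≠ bayes η x} ≤ P.real B + P.real (marginRegion η τ)ᶜ ∧
      risk (jointLaw P η) g - risk (jointLaw P η) (bayes η) ≤
        P.real B + τ * P.real (marginRegion η τ)ᶜ := by
  classical
  have hmem : ∀ x ∉ B, g x ≠ bayes η x → x ∈ (marginRegion η τ)ᶜ := by
    intro x hx hne
    have := h x hx hne
    simp only [marginRegion, Set.mem_compl_iff, Set.mem_ofPred_eq, not_le]
    linarith
  have hmargin : MeasurableSet (marginRegion η τ)ᶜ := by
    unfold marginRegion
    exact (measurableSet_le measurable_const (by fun_prop)).compl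
  refine ⟨(measureReal_mono fun x hx => ?_).trans (measureReal_union_le _ _), ?_⟩
  · by_cases hxB : x ∈ B
    · exact Or.inl hxB
    · exact Or.inr (hmem x hxB hx)
  have hint : ∀ {f : M → Fin 2}, Measurable f →
      Integrable (fun x => if f x = 1 then 1 - η x else η x) P := by
    intro f hf
    have hm : Measurable fun x => if f x = 1 then 1 - η x else η x :=
      Measurable.ite (hf (measurableSet_singleton 1)) (by fun_prop) hη
    refine Integrable.of_bound hm.aestronglyMeasurable 1 (Filter.Eventually.of_forall fun x => ?_)
    obtain ⟨h0, h1⟩ := hη01 x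
    split_ifs <;> rw [Real.norm_eq_abs, abs_le] <;> constructor <;> linarith
  have hbm := measurable_bayes hη
  rw [risk_eq_integral hη hη01 hg, risk_eq_integral hη hη01 hbm,
    ← integral_sub (hint hg) (hint hbm)]
  have hiB : Integrable (B.indicator fun _ => (1 : ℝ)) P := (integrable_const _).indicator hB
  have hiM : Integrable ((marginRegion η τ)ᶜ.indicator fun _ => τ) P :=
    (integrable_const _).indicator hmargin
  calc _ ≤ ∫ x, (B.indicator (fun _ => (1 : ℝ)) x +
        (marginRegion η τ)ᶜ.indicator (fun _ => τ) x) ∂P := by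
        refine integral_mono ((hint hg).sub (hint hbm)) (hiB.add hiM) fun x => ?_
        obtain ⟨h0, h1⟩ := hη01 x
        have hM0 : 0 ≤ (marginRegion η τ)ᶜ.indicator (fun _ => τ) x :=
          Set.indicator_nonneg (fun _ _ => hτ.le) x
        have hB0 : 0 ≤ B.indicator (fun _ => (1 : ℝ)) x :=
          Set.indicator_nonneg (fun _ _ => zero_le_one) x
        show (if g x = 1 then 1 - η x else η x) - (if bayes η x = 1 then 1 - η x else η x) ≤ _
        by_cases hgx : g x = bayes η x
        · rw [hgx, sub_self]
          exact add_nonneg hB0 hM0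
        have hdiff : (if g x = 1 then 1 - η x else η x) -
            (if bayes η x = 1 then 1 - η x else η x) ≤ 2 * |1 / 2 - η x| := by
          have e1 := neg_abs_le (1 / 2 - η x)
          have e2 := le_abs_self (1 / 2 - η x)
          have e3 := abs_nonneg (1 / 2 - η x)
          split_ifs <;> linarith
        by_cases hxB : x ∈ B
        · rw [Set.indicator_of_mem hxB]
          have : |1 / 2 - η x| ≤ 1 / 2 := abs_le.mpr ⟨by linarith, by linarith⟩
          linarith
        · have := h x hxB hgx
          rw [Set.indicator_of_mem (hmem x hxB hgx)]
          linarith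
    _ = P.real B + τ * P.real (marginRegion η τ)ᶜ := by
        rw [integral_add hiB hiM, integral_indicator_const _ hB, integral_indicator_const _ hmargin]
        simp [mul_comm]

/-- A noise exponent is never negative, because a margin above `1/2` is impossible. -/
theorem TsybakovNoise.nonneg {β : ℝ} (hη01 : ∀ x, η x ∈ Set.Icc (0 : ℝ) 1)
    (h : TsybakovNoise P η β) : 0 ≤ β := by
  obtain ⟨C, hC⟩ := h
  by_contra! hβ
  have hlim : Filter.Tendsto (fun Δ : ℝ => C * Δ ^ β) Filter.atTop (nhds (C * 0)) := by
    have := tendsto_rpow_neg_atTop (y := -β) (by linarith)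
    simp only [neg_neg] at this
    exact this.const_mul C
  rw [mul_zero] at hlim
  obtain ⟨Δ, hΔ1, hΔ⟩ := ((hlim.eventually (gt_mem_nhds one_pos)).and
    (Filter.eventually_ge_atTop (1 : ℝ))).exists
  have hempty : (marginRegion η Δ)ᶜ = Set.univ := by
    ext x
    have h1 : |1 / 2 - η x| ≤ 1 / 2 :=
      abs_le.mpr ⟨by linarith [(hη01 x).2], by linarith [(hη01 x).1]⟩
    simp only [marginRegion, Set.mem_compl_iff, Set.mem_ofPred_eq, not_le, Set.mem_univ, iff_true]
    linarith
  have := hC Δ (by linarith)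
  rw [hempty, probReal_univ] at this
  linarith

end Excess

/-! ### The mass of small balls -/

theorem exists_ball_mass {D : ℕ} {𝒳 : Set (EuclideanSpace ℝ (Fin D))} (h𝒳 : MeasurableSet 𝒳)
    {P : Measure 𝒳} [IsProbabilityMeasure P] (hsupp : SupportRegular 𝒳)
    (hdens : DensityBoundedBelow P) :
    ∃ c r₀ : ℝ, 0 < c ∧ 0 < r₀ ∧ ∀ (x : 𝒳) (r : ℝ), 0 < r → r < r₀ →
      c * r ^ D ≤ P.real (Metric.closedBall x r) := by
  obtain ⟨ω, r₀, hω, hr₀, hvol⟩ := hsupp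
  obtain ⟨p, hp, hPp, hinf⟩ := hdens
  set m : ℝ := (min (⨅ x, p x) 1).toReal with hm
  have hmtop : min (⨅ x, p x) 1 ≠ ⊤ := ne_top_of_le_ne_top ENNReal.one_ne_top (min_le_right _ _)
  have hm0 : 0 < m := ENNReal.toReal_pos (lt_min hinf one_pos).ne' hmtop
  have hmp : ∀ x, ENNReal.ofReal m ≤ p x := fun x => by
    rw [hm, ENNReal.ofReal_toReal hmtop]
    exact (min_le_left _ _).trans (iInf_le p x)
  set v : ℝ := (volume : Measure (EuclideanSpace ℝ (Fin D))).real (Metric.ball 0 1) with hv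
  have hv0 : 0 < v := ENNReal.toReal_pos (Metric.measure_ball_pos _ _ one_pos).ne'
    measure_ball_lt_top.ne
  refine ⟨m * ω * v, r₀, by positivity, hr₀, fun x r hr hrr => ?_⟩
  have hball : MeasurableSet (Metric.closedBall x r) := Metric.isClosed_closedBall.measurableSet
  have himg : Subtype.val '' Metric.closedBall x r =
      𝒳 ∩ Metric.closedBall (x : EuclideanSpace ℝ (Fin D)) r := by
    ext y
    constructor
    · rintro ⟨y, hy, rfl⟩
      exact ⟨y.2, hy⟩
    · rintro ⟨hy, hyr⟩
      exact ⟨⟨y, hy⟩, hyr, rfl⟩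
  have hvb : volume (Metric.closedBall (x : EuclideanSpace ℝ (Fin D)) r) =
      ENNReal.ofReal (r ^ D * v) := by
    rw [Measure.addHaar_closedBall _ _ hr.le, finrank_euclideanSpace_fin,
      ENNReal.ofReal_mul (by positivity), hv, ofReal_measureReal measure_ball_lt_top.ne]
  have key : ENNReal.ofReal (m * ω * v * r ^ D) ≤ P (Metric.closedBall x r) := by
    calc ENNReal.ofReal (m * ω * v * r ^ D)
        = ENNReal.ofReal m * (ENNReal.ofReal ω *
            volume (Metric.closedBall (x : EuclideanSpace ℝ (Fin D)) r)) := by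
          rw [hvb, ← ENNReal.ofReal_mul hω.le, ← ENNReal.ofReal_mul hm0.le]
          ring_nf
      _ ≤ ENNReal.ofReal m * volume (Subtype.val '' Metric.closedBall x r) := by
          rw [himg]
          gcongr
          exact hvol x x.2 r hr hrr
      _ = ENNReal.ofReal m * ((volume : Measure (EuclideanSpace ℝ (Fin D))).comap Subtype.val)
            (Metric.closedBall x r) := by
          rw [(MeasurableEmbedding.subtype_coe h𝒳).comap_apply]
      _ = ∫⁻ _ in Metric.closedBall x r, ENNReal.ofReal m
            ∂((volume : Measure (EuclideanSpace ℝ (Fin D))).comap Subtype.val) := by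
          rw [setLIntegral_const]
      _ ≤ ∫⁻ y in Metric.closedBall x r, p y
            ∂((volume : Measure (EuclideanSpace ℝ (Fin D))).comap Subtype.val) :=
          lintegral_mono hmp
      _ = P (Metric.closedBall x r) := by rw [hPp, withDensity_apply _ hball]
  exact (ENNReal.ofReal_le_iff_le_toReal (measure_ne_top _ _)).mp key

/-! ### The rate and the good event -/

section Rate

variable {D n k : ℕ} {α δ : ℝ}

theorem log_add_log_pos (hδ : 0 < δ) (hδ1 : δ < 1) :
    0 < Real.log n + Real.log (1 / δ) := by
  have h1 : 0 ≤ Real.log n := Real.log_natCast_nonneg n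
  have h2 : 0 < Real.log (1 / δ) := Real.log_pos (by rw [lt_div_iff₀ hδ]; linarith)
  linarith

theorem sqrt_le_rateLambda :
    √((Real.log n + Real.log (1 / δ)) / k) ≤ rateLambda D α δ n k :=
  le_add_of_nonneg_right (by positivity)

theorem rpow_le_rateLambda : ((k : ℝ) / n) ^ (α / D) ≤ rateLambda D α δ n k :=
  le_add_of_nonneg_left (Real.sqrt_nonneg _)

theorem rateLambda_pos (hn : 1 ≤ n) (hk : 1 ≤ k) : 0 < rateLambda D α δ n k :=
  (Real.rpow_pos_of_pos (by positivity) _).trans_le rpow_le_rateLambda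

/-- The measure allotted to the unreliable points is below the corresponding power of the rate. -/
theorem rpow_neg_le_rateLambda_rpow (hα : 0 < α) (hn : 1 ≤ n) (hk : 1 ≤ k) {e : ℝ} (he : 0 ≤ e) :
    (n : ℝ) ^ (-(α / D * e)) ≤ rateLambda D α δ n k ^ e := by
  have hn0 : (0 : ℝ) < n := by exact_mod_cast hn
  have hk1 : (1 : ℝ) ≤ k := by exact_mod_cast hk
  calc (n : ℝ) ^ (-(α / D * e)) = ((1 / (n : ℝ)) ^ (α / D)) ^ e := by
        rw [← Real.rpow_mul (by positivity), one_div, Real.inv_rpow hn0.le, Real.rpow_neg hn0.le]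
    _ ≤ (((k : ℝ) / n) ^ (α / D)) ^ e := by gcongr
    _ ≤ rateLambda D α δ n k ^ e :=
        Real.rpow_le_rpow (by positivity) rpow_le_rateLambda he

/-- The rate for `k` of the order of `n ^ (2 α / (2 α + D))`, which balances its two terms. -/
theorem rateLambda_le_of_balanced (hα : 0 < α) (hn : 1 ≤ n) (hk : 1 ≤ k) (hD : 1 ≤ D) (hδ : 0 < δ)
    (hδ1 : δ < 1) {a b : ℝ} (ha : 0 < a) (hak : a * (n : ℝ) ^ (2 * α / (2 * α + D)) ≤ k)
    (hkb : k ≤ b * (n : ℝ) ^ (2 * α / (2 * α + D))) :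
    rateLambda D α δ n k ≤ ((√a)⁻¹ + |b| ^ (α / D) + 1) *
      (1 + Real.log n + Real.log (1 / δ)) ^ (1 / 2 : ℝ) * (n : ℝ) ^ (-(α / (2 * α + D))) := by
  have hn0 : (0 : ℝ) < n := by exact_mod_cast hn
  have hD0 : (0 : ℝ) < D := by exact_mod_cast hD
  have hL := log_add_log_pos (n := n) hδ hδ1
  set L := Real.log n + Real.log (1 / δ) with hLdef
  set u := α / (2 * α + D) with hu
  have hexp : 2 * α / (2 * α + D) = u + u := by rw [hu]; ring
  have hnu : 0 < (n : ℝ) ^ u := Real.rpow_pos_of_pos hn0 _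
  rw [hexp] at hak hkb
  rw [show 1 + Real.log n + Real.log (1 / δ) = 1 + L by rw [hLdef]; ring, ← Real.sqrt_eq_rpow]
  have hsL : 1 ≤ √(1 + L) := Real.one_le_sqrt.mpr (by linarith)
  have h1 : √(L / k) ≤ (√a)⁻¹ * √(1 + L) * (n : ℝ) ^ (-u) := by
    calc √(L / k) ≤ √((1 + L) / (a * (n : ℝ) ^ (u + u))) := by
          gcongr
          linarith
      _ = (√a)⁻¹ * √(1 + L) * (n : ℝ) ^ (-u) := by
          rw [Real.sqrt_div (by linarith), Real.sqrt_mul ha.le, Real.rpow_add hn0,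
            Real.sqrt_mul_self hnu.le, Real.rpow_neg hn0.le]
          field_simp
  have h2 : ((k : ℝ) / n) ^ (α / D) ≤ |b| ^ (α / D) * (n : ℝ) ^ (-u) := by
    calc ((k : ℝ) / n) ^ (α / D) ≤ (|b| * (n : ℝ) ^ (u + u - 1)) ^ (α / D) := by
          gcongr
          rw [div_le_iff₀ hn0, mul_assoc, ← Real.rpow_add_one hn0.ne', sub_add_cancel]
          exact hkb.trans (mul_le_mul_of_nonneg_right (le_abs_self b) (by positivity))
      _ = |b| ^ (α / D) * (n : ℝ) ^ (-u) := by
          rw [Real.mul_rpow (abs_nonneg b) (by positivity), ← Real.rpow_mul hn0.le]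
          congr 2
          rw [hu]
          field_simp
          ring
  have hnn : 0 < (n : ℝ) ^ (-u) := Real.rpow_pos_of_pos hn0 _
  have hb0 : 0 ≤ |b| ^ (α / D) := by positivity
  have h3 : |b| ^ (α / D) * (n : ℝ) ^ (-u) ≤ |b| ^ (α / D) * √(1 + L) * (n : ℝ) ^ (-u) := by
    gcongr
    exact le_mul_of_one_le_right hb0 hsL
  have h4 : 0 ≤ √(1 + L) * (n : ℝ) ^ (-u) := by positivity
  calc rateLambda D α δ n k = √(L / k) + ((k : ℝ) / n) ^ (α / D) := rfl
    _ ≤ (√a)⁻¹ * √(1 + L) * (n : ℝ) ^ (-u) + |b| ^ (α / D) * √(1 + L) * (n : ℝ) ^ (-u) :=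
        add_le_add h1 (h2.trans h3)
    _ ≤ _ := by linarith

end Rate

/-- The union bound over all scales and all boundary examples costs a factor `n ^ 4`, which the
choice of the confidence `4 (4 + γ) (log n + log (1 / δ))` absorbs. -/
theorem union_bound_le {n : ℕ} (hn : 2 ≤ n) {δ γ : ℝ} (hδ : 0 < δ) (hδ1 : δ < 1) (hγ : 0 ≤ γ)
    {N : ℕ} (hN : N ≤ n) :
    N * ((2 * n + 1) *
        Real.exp (-(4 * (4 + γ) * (Real.log n + Real.log (1 / δ)) / 4))) / (n : ℝ) ^ (-γ) ≤ δ := by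
  have hn2 : (2 : ℝ) ≤ n := by exact_mod_cast hn
  have hn0 : (0 : ℝ) < n := by linarith
  have hexp : Real.exp (-(4 * (4 + γ) * (Real.log n + Real.log (1 / δ)) / 4)) ≤
      (n : ℝ) ^ (-(4 : ℝ)) * (n : ℝ) ^ (-γ) * δ := by
    rw [← Real.rpow_add hn0, Real.rpow_def_of_pos hn0]
    nth_rewrite 2 [← Real.exp_log hδ]
    rw [← Real.exp_add]
    refine Real.exp_le_exp.mpr ?_
    rw [one_div, Real.log_inv]
    have := Real.log_neg hδ hδ1
    nlinarith
  have hγn : 0 < (n : ℝ) ^ (-γ) := Real.rpow_pos_of_pos hn0 _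
  rw [div_le_iff₀ hγn]
  have h4 : (n : ℝ) * (2 * n + 1) * (n : ℝ) ^ (-(4 : ℝ)) ≤ 1 := by
    rw [Real.rpow_neg hn0.le, ← div_eq_mul_inv, div_le_one (by positivity)]
    norm_cast
    nlinarith [Nat.mul_le_mul hn hn, Nat.mul_le_mul (Nat.mul_le_mul hn hn) (Nat.mul_le_mul hn hn)]
  calc _ ≤ (n : ℝ) * ((2 * n + 1) * ((n : ℝ) ^ (-(4 : ℝ)) * (n : ℝ) ^ (-γ) * δ)) := by gcongr
    _ = ((n : ℝ) * (2 * n + 1) * (n : ℝ) ^ (-(4 : ℝ))) * (δ * (n : ℝ) ^ (-γ)) := by ring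
    _ ≤ 1 * (δ * (n : ℝ) ^ (-γ)) := by gcongr
    _ = δ * (n : ℝ) ^ (-γ) := one_mul _

/-- Points of `C` are farther apart than the diameter of a ball whose radius is small compared
with `(k / n) ^ (1 / D)`, once `k` is at most a small multiple of `n` times the `D`-th power of the
separation of `C`. -/
theorem two_mul_lt_dist_of_le_einfsep {M : Type*} [MetricSpace M] {D n k : ℕ} {C : Finset M}
    {Ku r : ℝ} (hKu : 0 < Ku) (hr : 0 ≤ r) (hlt : Ku * (2 * r) ^ D * n < k)
    (hC : (k : ℝ≥0∞) ≤ ENNReal.ofReal Ku * Set.einfsep (C : Set M) ^ D * n) :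
    ∀ c ∈ C, ∀ c' ∈ C, c ≠ c' → 2 * r < dist c c' := by
  intro c hc c' hc' hne
  by_contra! hle
  have hsep : Set.einfsep (C : Set M) ≤ ENNReal.ofReal (2 * r) := by
    refine (Set.einfsep_le_edist_of_mem hc hc' hne).trans ?_
    rw [edist_dist]
    exact ENNReal.ofReal_le_ofReal hle
  have : (k : ℝ≥0∞) ≤ ENNReal.ofReal (Ku * (2 * r) ^ D * n) := by
    rw [ENNReal.ofReal_mul (by positivity), ENNReal.ofReal_mul hKu.le,
      ENNReal.ofReal_pow (by positivity), ENNReal.ofReal_natCast]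
    exact hC.trans (by gcongr)
  rw [← ENNReal.ofReal_natCast, ENNReal.ofReal_le_ofReal_iff (by positivity)] at this
  linarith

/-- With high probability over the clean sample, outside a set of polynomially small measure every
`k`-NN classifier only errs where the margin is of the order of the rate, whatever the corrupted
points and the scale `k`. The rate is assumed small, since the claim is only needed then. -/
theorem exists_event_margin_le {D : ℕ} (hD : 1 ≤ D) {M : Type*} [MetricSpace M] [MeasurableSpace M]
    [BorelSpace M] [SecondCountableTopology M] {P : Measure M} [IsProbabilityMeasure P]
    {η : M → ℝ} (hη : Measurable η) (hη01 : ∀ x, η x ∈ Set.Icc (0 : ℝ) 1) {α : ℝ} (hα : 0 < α)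
    (hholder : HolderRegular η α) {c r₀ : ℝ} (hc : 0 < c) (hr₀ : 0 < r₀)
    (hmass : ∀ (x : M) (r : ℝ), 0 < r → r < r₀ → c * r ^ D ≤ P.real (Metric.closedBall x r))
    {γ : ℝ} (hγ : 0 ≤ γ) :
    ∃ Ku q C₁ : ℝ, 0 < Ku ∧ 0 < q ∧ q ≤ 1 ∧ 0 < C₁ ∧
      ∀ δ : ℝ, 0 < δ → δ < 1 → ∀ n : ℕ, 1 ≤ n →
        ∃ G : Set (Fin n → M × Fin 2), MeasurableSet G ∧
          ENNReal.ofReal (1 - δ) ≤ Measure.pi (fun _ : Fin n => jointLaw P η) G ∧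
          ∀ s ∈ G, ∃ B : Set M, MeasurableSet B ∧ P.real B ≤ (n : ℝ) ^ (-γ) ∧
            ∀ (C : Finset M) (ℓ : M → Fin 2) (k : ℕ), 1 ≤ k →
              (k : ℝ≥0∞) ≤ ENNReal.ofReal Ku * Set.einfsep (C : Set M) ^ D * n →
              rateLambda D α δ n k < q →
              ∀ g : M → Fin 2, IsKNNClassifier k (corruptedSample s C ℓ) g →
                ∀ x ∉ B, g x ≠ bayes η x → |1 / 2 - η x| ≤ C₁ * rateLambda D α δ n k := by
  obtain ⟨Cα, hCα, hhol⟩ := hholder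
  have hD0 : (0 : ℝ) < D := by exact_mod_cast hD
  have hαD : 0 < α / D := by positivity
  set κ : ℝ := min 1 (c * r₀ ^ D / 2) with hκ
  have hκ0 : 0 < κ := lt_min one_pos (by positivity)
  set m : ℝ := 4 * (4 + γ) with hm
  have hm0 : 0 < m := by positivity
  refine ⟨c / 2 ^ (D + 2), min (κ ^ (α / D)) (√m)⁻¹, 4 * √m + Cα * (2 / c) ^ (α / D),
    by positivity, lt_min (by positivity) (by positivity),
    (min_le_left _ _).trans (Real.rpow_le_one hκ0.le (min_le_left _ _) hαD.le), by positivity, ?_⟩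
  intro δ hδ hδ1 n hn
  have hn0 : (0 : ℝ) < n := by exact_mod_cast hn
  have hL := log_add_log_pos (n := n) hδ hδ1
  set L := Real.log n + Real.log (1 / δ) with hLdef
  set r : ℕ → ℝ := fun k => (2 * k / (c * n)) ^ (1 / (D : ℝ)) with hr
  have hrD : ∀ k, r k ^ D = 2 * k / (c * n) := fun k => by
    rw [hr, ← Real.rpow_natCast, ← Real.rpow_mul (by positivity), one_div,
      inv_mul_cancel₀ hD0.ne', Real.rpow_one]
  have hr0 : ∀ k, 0 ≤ r k := fun k => by positivity
  -- A rate below the threshold forces `k` into the range where balls are regular and the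
  -- exponential bounds apply.
  have hrange : ∀ k : ℕ, 1 ≤ k → rateLambda D α δ n k < min (κ ^ (α / D)) (√m)⁻¹ →
      m * L ≤ k ∧ (k : ℝ) < κ * n := by
    intro k hk hlt
    have hk0 : (0 : ℝ) < k := by exact_mod_cast hk
    obtain ⟨h1, h2⟩ := lt_min_iff.mp hlt
    constructor
    · have h3 : √(L / k) < √(m⁻¹) := by
        rw [Real.sqrt_inv]
        exact sqrt_le_rateLambda.trans_lt h2
      have h4 := (Real.sqrt_lt_sqrt_iff (by positivity)).mp h3
      rw [div_lt_iff₀ hk0, inv_mul_eq_div, lt_div_iff₀ hm0] at h4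
      linarith
    · have h3 := rpow_le_rateLambda.trans_lt h1
      rw [Real.rpow_lt_rpow_iff (by positivity) hκ0.le hαD] at h3
      exact (div_lt_iff₀ hn0).mp h3
  rcases Nat.lt_or_ge n 2 with hn2 | hn2
  · -- A single example: the rate is at least one, so that nothing is claimed.
    obtain rfl : n = 1 := by omega
    have := isProbabilityMeasure_jointLaw (P := P) hη hη01
    refine ⟨Set.univ, MeasurableSet.univ, ?_, fun s _ => ⟨∅, MeasurableSet.empty, by simp, ?_⟩⟩
    · rw [measure_univ]
      exact ENNReal.ofReal_le_one.mpr (by linarith)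
    · intro C ℓ k hk _ hlt
      have h1 := (hrange k hk hlt).2
      have h2 : (1 : ℝ) ≤ k := by exact_mod_cast hk
      have h3 : κ ≤ 1 := min_le_left _ _
      simp only [Nat.cast_one, mul_one] at h1
      linarith
  classical
  set A : Finset ℕ := (Finset.range n).filter fun k => 1 ≤ k ∧ m * L ≤ k ∧ (k : ℝ) < κ * n with hA
  have hT1 : 1 ≤ m * L := by
    have h1 : Real.log 2 ≤ Real.log n := Real.log_le_log two_pos (by exact_mod_cast hn2)
    have h2 := Real.log_two_gt_d9
    have h3 : 0 < Real.log (1 / δ) := Real.log_pos (by rw [lt_div_iff₀ hδ]; linarith)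
    have h4 : (16 : ℝ) ≤ m := by rw [hm]; linarith
    nlinarith
  obtain ⟨G, hGm, hG, hGs⟩ := exists_event_reliable (P := P) n hη hη01 A (r := r) (T := m * L)
    (ε := (n : ℝ) ^ (-γ)) (by positivity) (by linarith)
    (fun k hk => (Finset.mem_filter.mp hk).2.2.1) (fun k hk x => by
      obtain ⟨-, hk1, -, hkκ⟩ := Finset.mem_filter.mp hk
      have hk0 : (0 : ℝ) < k := by exact_mod_cast hk1
      have hlt : r k < r₀ := by
        refine lt_of_pow_lt_pow_left₀ D hr₀.le ?_
        rw [hrD, div_lt_iff₀ (by positivity)]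
        have : κ * n ≤ c * r₀ ^ D / 2 * n := by
          gcongr
          exact min_le_right _ _
        linarith
      have h1 := hmass x (r k) (Real.rpow_pos_of_pos (by positivity) _) hlt
      rw [hrD] at h1
      calc 2 * (k : ℝ) = n * (c * (2 * k / (c * n))) := by field_simp
        _ ≤ _ := by gcongr)
  refine ⟨G, hGm, le_trans (ENNReal.ofReal_le_ofReal ?_) hG, fun s hs => ?_⟩
  · have := union_bound_le hn2 hδ hδ1 hγ
      ((Finset.card_filter_le _ _).trans (Finset.card_range n).le : A.card ≤ n)
    exact sub_le_sub_left this 1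
  · obtain ⟨B, hBm, hB, hBr⟩ := hGs s hs
    refine ⟨B, hBm, hB, fun C ℓ k hk hC hlt g hg x hx hne => ?_⟩
    have hk0 : (0 : ℝ) < k := by exact_mod_cast hk
    obtain ⟨hTk, hkκ⟩ := hrange k hk hlt
    have hkn : k < n := by
      have : κ * n ≤ 1 * n := by
        gcongr
        exact min_le_left _ _
      have : (k : ℝ) < n := by linarith
      exact_mod_cast this
    have hkA : k ∈ A := Finset.mem_filter.mpr ⟨Finset.mem_range.mpr hkn, hk, hTk, hkκ⟩
    have hsep := two_mul_lt_dist_of_le_einfsep (r := r k) (by positivity) (hr0 k) (by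
      rw [mul_pow, hrD, pow_add]
      calc _ = (k : ℝ) / 2 := by field_simp
        _ < k := by linarith) hC
    have hbias : ∀ y, dist y x ≤ r k → |η y - η x| ≤ Cα * r k ^ α := fun y hy =>
      (hhol y x).trans (by gcongr)
    have hmargin := (hBr x hx k hkA).margin_le hη01 hT1 hk (hr0 k) hsep hbias hg hne
    have hrα : r k ^ α = (2 / c) ^ (α / D) * ((k : ℝ) / n) ^ (α / D) := by
      rw [hr, ← Real.rpow_mul (by positivity), ← Real.mul_rpow (by positivity) (by positivity)]
      congr 1
      · field_simp
      · field_simp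
    calc |1 / 2 - η x| ≤ 4 * √(m * L / k) + Cα * r k ^ α := hmargin
      _ = 4 * √m * √(L / k) + Cα * (2 / c) ^ (α / D) * ((k : ℝ) / n) ^ (α / D) := by
          rw [hrα, mul_div_assoc, Real.sqrt_mul hm0.le]
          ring
      _ ≤ 4 * √m * rateLambda D α δ n k + Cα * (2 / c) ^ (α / D) * rateLambda D α δ n k := by
          gcongr
          · exact sqrt_le_rateLambda
          · exact rpow_le_rateLambda
      _ = _ := by ring

/-! ### Error rates of nearest neighbours under separated corruption -/

theorem theorem3 {D : ℕ} (hD : 1 ≤ D)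
    (𝒳 : Set (EuclideanSpace ℝ (Fin D))) (h𝒳 : IsCompact 𝒳)
    (P : Measure 𝒳) [IsProbabilityMeasure P]
    (η : 𝒳 → ℝ) (hη : Measurable η) (hη01 : ∀ x, η x ∈ Set.Icc (0 : ℝ) 1)
    (α β : ℝ) (hα0 : 0 < α) (hα1 : α ≤ 1)
    (hsupp : SupportRegular 𝒳)
    (hdens : DensityBoundedBelow P)
    (hholder : HolderRegular η α)
    (htsyb : TsybakovNoise P η β) :
    ∃ Kl Ku K K' : ℝ, ∃ K'' : ℝ → ℝ → ℝ,
      0 < Kl ∧ 0 < Ku ∧ 0 < K ∧ 0 < K' ∧ (∀ a b, 0 < K'' a b) ∧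
      ∀ δ : ℝ, 0 < δ → ∀ n : ℕ, 1 ≤ n →
        ∃ G : Set (Fin n → 𝒳 × Fin 2), MeasurableSet G ∧
          ENNReal.ofReal (1 - δ) ≤ Measure.pi (fun _ : Fin n => jointLaw P η) G ∧
          ∀ s ∈ G, ∀ (C : Finset 𝒳) (ℓ : 𝒳 → Fin 2) (k : ℕ), 1 ≤ k →
            KRange D α δ Kl Ku n k C →
            ∀ g : 𝒳 → Fin 2, IsKNNClassifier k (corruptedSample s C ℓ) g →
              P.real {x | g x ≠ bayes η x} ≤ K * rateLambda D α δ n k ^ β ∧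
              risk (jointLaw P η) g - risk (jointLaw P η) (bayes η) ≤
                K' * rateLambda D α δ n k ^ (β + 1) ∧
              ∀ a b : ℝ, 0 < a → a * (n : ℝ) ^ (2 * α / (2 * α + D)) ≤ k →
                k ≤ b * (n : ℝ) ^ (2 * α / (2 * α + D)) →
                risk (jointLaw P η) g - risk (jointLaw P η) (bayes η) ≤
                  K'' a b * (1 + Real.log n + Real.log (1 / δ)) ^ ((β + 1) / 2) *
                    (n : ℝ) ^ (-(α * (β + 1) / (2 * α + D))) := by
  have hβ : 0 ≤ β := htsyb.nonneg hη01
  obtain ⟨Cβ, hCβ⟩ := htsyb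
  obtain ⟨c, r₀, hc, hr₀, hmass⟩ := exists_ball_mass h𝒳.isClosed.measurableSet hsupp hdens
  have hD0 : (0 : ℝ) < D := by exact_mod_cast hD
  obtain ⟨Ku, q, C₁, hKu, hq, hq1, hC₁, hevent⟩ := exists_event_margin_le (P := P) hD hη hη01 hα0
    hholder hc hr₀ hmass (γ := α / D * (β + 1)) (by positivity)
  set Q : ℝ := |Cβ| * (2 * C₁) ^ β with hQ
  have hQ0 : 0 ≤ Q := by positivity
  set K : ℝ := (q⁻¹) ^ β + 1 + Q with hK
  set K' : ℝ := (q⁻¹) ^ (β + 1) + 1 + 2 * C₁ * Q with hK'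
  have hK0 : 0 < K := by positivity
  have hK'0 : 0 < K' := by positivity
  refine ⟨1, Ku, K, K', fun a b => K' * ((√a)⁻¹ + |b| ^ (α / D) + 1) ^ (β + 1), one_pos, hKu, hK0,
    hK'0, fun a b => by positivity, ?_⟩
  intro δ hδ n hn
  rcases le_or_gt 1 δ with hδ1 | hδ1
  · -- Confidence `1 - δ ≤ 0` asks for nothing.
    exact ⟨∅, MeasurableSet.empty, by simp [ENNReal.ofReal_eq_zero.mpr (sub_nonpos.mpr hδ1)],
      fun s hs => hs.elim⟩
  obtain ⟨G, hGm, hG, hGs⟩ := hevent δ hδ hδ1 n hn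
  refine ⟨G, hGm, hG, fun s hs C ℓ k hk hrange g hg => ?_⟩
  obtain ⟨B, hBm, hB, hmargin⟩ := hGs s hs
  have hprob := isProbabilityMeasure_jointLaw (P := P) hη hη01
  have hl0 : 0 < rateLambda D α δ n k := rateLambda_pos hn hk
  set l := rateLambda D α δ n k with hl
  have hmain : P.real {x | g x ≠ bayes η x} ≤ K * l ^ β ∧
      risk (jointLaw P η) g - risk (jointLaw P η) (bayes η) ≤ K' * l ^ (β + 1) := by
    rcases le_or_gt q l with hql | hql
    · -- For a large rate the bounds exceed one.
      have hlarge : ∀ e : ℝ, 0 ≤ e → 1 ≤ (q⁻¹) ^ e * l ^ e := fun e he => by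
        rw [← Real.mul_rpow (by positivity) hl0.le]
        refine Real.one_le_rpow ?_ he
        rwa [inv_mul_eq_div, one_le_div hq]
      constructor
      · refine measureReal_le_one.trans ((hlarge β hβ).trans ?_)
        gcongr
        rw [hK]; linarith
      · have h1 : risk (jointLaw P η) g ≤ 1 := measureReal_le_one
        have h2 : 0 ≤ risk (jointLaw P η) (bayes η) := measureReal_nonneg
        have h3 := hlarge (β + 1) (by positivity)
        have h4 : (q⁻¹) ^ (β + 1) * l ^ (β + 1) ≤ K' * l ^ (β + 1) := by
          gcongr
          have : 0 ≤ 2 * C₁ * Q := by positivity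
          rw [hK']; linarith
        linarith
    · have hτ : 0 < 2 * C₁ * l := by positivity
      obtain ⟨h1, h2⟩ := disagreement_and_excess_le (P := P) hη hη01 hg.1 hBm hτ
        (fun x hx hne => (hmargin C ℓ k hk hrange.2 hql g hg x hx hne).trans_eq (by ring))
      have hT : P.real (marginRegion η (2 * C₁ * l))ᶜ ≤ Q * l ^ β := by
        refine (hCβ _ hτ).trans ?_
        rw [Real.mul_rpow (by positivity) hl0.le, hQ, mul_assoc]
        gcongr
        exact le_abs_self Cβ
      have hBl : P.real B ≤ l ^ (β + 1) :=
        hB.trans (rpow_neg_le_rateLambda_rpow hα0 hn hk (by positivity))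
      have hBl' : P.real B ≤ l ^ β :=
        hBl.trans (Real.rpow_le_rpow_of_exponent_ge hl0 (hql.le.trans hq1) (by linarith))
      have hlβ : 0 < l ^ β := Real.rpow_pos_of_pos hl0 _
      constructor
      · have : 0 ≤ (q⁻¹) ^ β * l ^ β := by positivity
        calc _ ≤ l ^ β + Q * l ^ β := h1.trans (add_le_add hBl' hT)
          _ ≤ K * l ^ β := by rw [hK]; linarith
      · have : 0 ≤ (q⁻¹) ^ (β + 1) * l ^ (β + 1) := by positivity
        calc _ ≤ l ^ (β + 1) + 2 * C₁ * l * (Q * l ^ β) := by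
              refine h2.trans (add_le_add hBl ?_)
              gcongr
          _ = (1 + 2 * C₁ * Q) * l ^ (β + 1) := by rw [Real.rpow_add_one hl0.ne']; ring
          _ ≤ K' * l ^ (β + 1) := by rw [hK']; linarith
  refine ⟨hmain.1, hmain.2, fun a b ha hak hkb => hmain.2.trans ?_⟩
  have hbal := rateLambda_le_of_balanced hα0 hn hk hD hδ hδ1 ha hak hkb
  have hlog : 0 ≤ 1 + Real.log n + Real.log (1 / δ) := by
    linarith [log_add_log_pos (n := n) hδ hδ1]
  calc K' * l ^ (β + 1)
      ≤ K' * (((√a)⁻¹ + |b| ^ (α / D) + 1) * (1 + Real.log n + Real.log (1 / δ)) ^ (1 / 2 : ℝ) *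
          (n : ℝ) ^ (-(α / (2 * α + D)))) ^ (β + 1) := by gcongr
    _ = _ := by
        rw [Real.mul_rpow (by positivity) (by positivity),
          Real.mul_rpow (by positivity) (by positivity), ← Real.rpow_mul hlog,
          ← Real.rpow_mul (by positivity), ← mul_assoc, ← mul_assoc]
        congr 2
        · congr 1
          ring
        · ring
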